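/- \textbf{Corollary (a general version of the Frobenius $p$-nilpotency theorem).} Let $p$ be a prime, let $G$ be a finite group with $S\in \mathrm{Syl}_p(G)$, and let $D\le S$ be a subgroup that is strongly closed in $S$ with respect to $G$; that is, whenever $x\in D$, $g\in G$ and $x^g=g^{-1}xg\in S$, then $x^g\in D$. Then $G$ is $p$-nilpotent if and only if $N_G(U)$ is $p$-nilpotent for every subgroup $U\le D$ with $C_D(U)\le U$. Here a finite group is called $p$-nilpotent if it has a normal $p$-complement, i.e. a normal subgroup of order prime to $p$ whose index is a power of $p$. -/

import Mathlib

/-- A finite group `G` is `p`-nilpotent if it has a normal `p`-complement: a normal subgroup whose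
order is prime to `p` and whose index is a power of `p`. -/
def IsPNilpotent (p : ℕ) (G : Type*) [Group G] : Prop :=
  ∃ K : Subgroup G, K.Normal ∧ (Nat.card K).Coprime p ∧ ∃ n : ℕ, K.index = p ^ n

/-- `D ≤ S` is strongly closed in `S` with respect to the ambient group `G`: every `G`-conjugate of
an element of `D` that lies in `S` lies in `D`. -/
def IsStronglyClosed {G : Type*} [Group G] (D S : Subgroup G) : Prop :=
  D ≤ S ∧ ∀ x ∈ D, ∀ g : G, g⁻¹ * x * g ∈ S → g⁻¹ * x * g ∈ D

/-! Normalizers inherit `p`-nilpotency as subgroups. For the converse let `N` be O^p(G), generated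
by the elements of order prime to `p`; it suffices that S ∩ N = 1. As `N` has no nontrivial
homomorphism to a `p`-group, transfer shows that S ∩ N is its own focal subgroup in `N`. If `S`
controls the fusion of S ∩ N modulo a strongly closed `E`, this yields S ∩ N ≤ [S ∩ N, S]E, and
nilpotency of `S` gives S ∩ N ≤ E (`inf_primeToPSubgroup_le_of_forall_exists`).

This is used twice. With E = D, the case U = D of the hypothesis controls fusion and gives S ∩ N ≤
D. With E = 1, only fusion of elements of `D` matters, and the remaining `U` control it. Both
controls come from an Alperin-type theorem modulo `E` (`agreesModulo_of_forall_isFullyNormalized`),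
which reduces fusion to normalizers of suitable fully normalized subgroups. -/

open Subgroup
open scoped commutatorElement

/-! ### Conjugates of a subgroup -/

/-- The conjugate subgroup `g⁻¹ A g`. -/
def Subgroup.conjBy {G : Type*} [Group G] (A : Subgroup G) (g : G) : Subgroup G :=
  A.map (MulAut.conj g⁻¹).toMonoidHom

theorem Subgroup.mem_conjBy {G : Type*} [Group G] {A : Subgroup G} {g x : G} :
    x ∈ A.conjBy g ↔ g * x * g⁻¹ ∈ A := by
  constructor
  · rintro ⟨a, ha, rfl⟩
    simpa [mul_assoc] using ha
  · intro h
    exact ⟨_, h, by simp [mul_assoc]⟩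

theorem Subgroup.conj_mem_conjBy {G : Type*} [Group G] {A : Subgroup G} (g : G) {a : G}
    (ha : a ∈ A) : g⁻¹ * a * g ∈ A.conjBy g := by
  rw [mem_conjBy]
  simpa [mul_assoc] using ha

theorem Subgroup.card_conjBy {G : Type*} [Group G] (A : Subgroup G) (g : G) :
    Nat.card (A.conjBy g) = Nat.card A :=
  card_map_of_injective (MulAut.conj g⁻¹).injective

theorem IsPGroup.conjBy {G : Type*} [Group G] {p : ℕ} {A : Subgroup G} (hA : IsPGroup p A) (g : G) :
    IsPGroup p (A.conjBy g) :=
  hA.map _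

theorem Subgroup.mem_normalizer_of_conj_mem {G : Type*} [Group G] [Finite G] {B : Subgroup G}
    {n : G} (h : ∀ b ∈ B, n⁻¹ * b * n ∈ B) : n ∈ normalizer (B : Set G) := by
  have hle : B.conjBy n ≤ B := by
    rintro _ ⟨b, hb, rfl⟩
    simpa using h b hb
  have heq : B.conjBy n = B := eq_of_le_of_card_ge hle (B.card_conjBy n).ge
  rw [mem_normalizer_iff]
  intro x
  rw [← mem_conjBy, heq]

theorem Subgroup.conj_mem_of_mem_normalizer {G : Type*} [Group G] {B : Subgroup G} {n b : G}
    (hn : n ∈ normalizer (B : Set G)) (hb : b ∈ B) : n⁻¹ * b * n ∈ B :=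
  (mem_normalizer_iff''.mp hn b).mp hb

/-! ### Sylow subgroups -/

/-- A `p`-subgroup of a finite group is conjugate into any Sylow `p`-subgroup. -/
theorem Sylow.exists_conj_mem {G : Type*} [Group G] [Finite G] {p : ℕ} [Fact p.Prime]
    (S : Sylow p G) {R : Subgroup G} (hR : IsPGroup p R) :
    ∃ g : G, ∀ r ∈ R, g⁻¹ * r * g ∈ (S : Subgroup G) := by
  obtain ⟨Q, hQ⟩ := hR.exists_le_sylow
  obtain ⟨g, rfl⟩ := MulAction.exists_smul_eq G S Q
  refine ⟨g, fun r hr => ?_⟩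
  obtain ⟨s, hs, rfl⟩ := hQ hr
  change _ ∈ S
  simpa [mul_assoc] using hs

/-- A Sylow subgroup meets a normal subgroup in a Sylow subgroup. -/
theorem Sylow.exists_coe_eq_subgroupOf {G : Type*} [Group G] [Finite G] {p : ℕ} [Fact p.Prime]
    (S : Sylow p G) (N : Subgroup G) [N.Normal] :
    ∃ P : Sylow p N, (P : Subgroup N) = (S : Subgroup G).subgroupOf N := by
  have key : (S : Subgroup G).relIndex N = (S : Subgroup G).relIndex (S ⊔ N) := by
    have h1 := relIndex_mul_relIndex ((S : Subgroup G) ⊓ N) S (S ⊔ N) inf_le_left le_sup_left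
    have h2 := relIndex_mul_relIndex ((S : Subgroup G) ⊓ N) N (S ⊔ N) inf_le_right le_sup_right
    rw [relIndex_sup_right, inf_relIndex_right] at h2
    rw [inf_relIndex_left, ← h2, mul_comm] at h1
    exact (Nat.eq_of_mul_eq_mul_right (Nat.pos_of_ne_zero
      (index_ne_zero_of_finite)) h1).symm
  have hdvd : ¬ p ∣ ((S : Subgroup G).subgroupOf N).index := fun h => S.not_dvd_index <|
    (h.trans (dvd_of_eq key)).trans (relIndex_dvd_index_of_le le_sup_left)
  exact ⟨(S.2.comap_subtype).toSylow hdvd, rfl⟩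

theorem IsPGroup.exists_mem_normalizer_notMem {G : Type*} [Group G] [Finite G] {p : ℕ}
    [Fact p.Prime] {T A : Subgroup G} (hT : IsPGroup p T) (hA : A ≤ T) (hTA : ¬ T ≤ A) :
    ∃ x ∈ T, x ∈ normalizer (A : Set G) ∧ x ∉ A := by
  have := hT.isNilpotent
  have hlt := Group.normalizerCondition_of_isNilpotent (G := T) (A.subgroupOf T)
    (lt_top_iff_ne_top.mpr fun h => hTA (subgroupOf_eq_top.mp h))
  obtain ⟨x, hx, hxA⟩ := SetLike.exists_of_lt hlt
  rw [← subgroupOf_normalizer_eq hA] at hx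
  exact ⟨x, x.2, hx, hxA⟩

/-! ### Strongly closed subgroups -/

theorem IsStronglyClosed.conj_mem {G : Type*} [Group G] {D S : Subgroup G}
    (hD : IsStronglyClosed D S) {x s : G} (hx : x ∈ D) (hs : s ∈ S) : s⁻¹ * x * s ∈ D :=
  hD.2 x hx s (S.mul_mem (S.mul_mem (S.inv_mem hs) (hD.1 hx)) hs)

theorem IsStronglyClosed.conj_mem' {G : Type*} [Group G] {D S : Subgroup G}
    (hD : IsStronglyClosed D S) {x s : G} (hx : x ∈ D) (hs : s ∈ S) : s * x * s⁻¹ ∈ D := by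
  simpa using hD.conj_mem hx (S.inv_mem hs)

theorem isStronglyClosed_self {G : Type*} [Group G] (S : Subgroup G) : IsStronglyClosed S S :=
  ⟨le_rfl, fun _ _ _ h => h⟩

theorem isStronglyClosed_bot {G : Type*} [Group G] (S : Subgroup G) : IsStronglyClosed ⊥ S :=
  ⟨bot_le, fun x hx g _ => by simp [mem_bot.mp hx]⟩

theorem IsStronglyClosed.le_normalizer {G : Type*} [Group G] [Finite G] {D S : Subgroup G}
    (hD : IsStronglyClosed D S) : S ≤ normalizer (D : Set G) := fun _ hs =>
  mem_normalizer_of_conj_mem fun _ hb => hD.conj_mem hb hs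

/-! ### `p`-nilpotent groups -/

theorem IsPNilpotent.subgroup {G : Type*} [Group G] [Finite G] {p : ℕ} [Fact p.Prime]
    (h : IsPNilpotent p G) (H : Subgroup G) : IsPNilpotent p H := by
  obtain ⟨K, hK, hcop, n, hn⟩ := h
  refine ⟨K.subgroupOf H, inferInstance, ?_, ?_⟩
  · refine hcop.coprime_dvd_left ?_
    rw [← card_map_of_injective H.subtype_injective, subgroupOf_map_subtype]
    exact card_dvd_of_le inf_le_left
  · obtain ⟨m, -, hm⟩ := (Nat.dvd_prime_pow Fact.out).mp (hn ▸ K.relIndex_dvd_index_of_normal H)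
    exact ⟨m, hm⟩

/-- A Sylow subgroup of a `p`-nilpotent group controls its own fusion. -/
theorem IsPNilpotent.exists_conj_eq {G : Type*} [Group G] [Finite G] {p : ℕ} [Fact p.Prime]
    (h : IsPNilpotent p G) (P : Sylow p G) {A : Subgroup G} {n : G} (hA : A ≤ P)
    (hn : ∀ a ∈ A, n⁻¹ * a * n ∈ P) : ∃ t ∈ P, ∀ a ∈ A, n⁻¹ * a * n = t⁻¹ * a * t := by
  obtain ⟨K, hK, hcop, m, hm⟩ := h
  have hcop' : (Nat.card K).Coprime (Nat.card P) := by
    obtain ⟨k, hk⟩ := P.2.exists_card_eq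
    exact hk ▸ hcop.pow_right k
  have hdisj : Disjoint K (P : Subgroup G) := disjoint_of_coprime_natCard hcop'
  have htop : K ⊔ (P : Subgroup G) = ⊤ := by
    rw [← index_eq_one]
    refine Nat.eq_one_of_dvd_coprimes (a := p ^ m) ?_
      (hm ▸ index_dvd_of_le le_sup_left) (index_dvd_of_le (le_sup_right (a := K)))
    exact ((Nat.Prime.coprime_iff_not_dvd Fact.out).mpr P.not_dvd_index).pow_left m
  obtain ⟨k, hk, t, ht, rfl⟩ := mem_sup_of_normal_left.mp (htop ▸ mem_top n)
  refine ⟨t, ht, fun a ha => ?_⟩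
  have h1 : k⁻¹ * a * k ∈ (P : Subgroup G) := by
    have := mul_mem (mul_mem ht (hn a ha)) (inv_mem ht)
    simpa [mul_assoc] using this
  -- This commutator of `k` and `a` lies in K ∩ P = 1.
  have h2 : k⁻¹ * (a * k * a⁻¹) = 1 :=
    disjoint_def.mp hdisj (mul_mem (inv_mem hk) (hK.conj_mem k hk a))
      (by simpa [mul_assoc] using mul_mem h1 (inv_mem (hA ha)))
  have h3 : k⁻¹ * a * k = a := by
    rw [← mul_assoc, mul_inv_eq_one, ← mul_assoc] at h2
    exact h2
  calc (k * t)⁻¹ * a * (k * t) = t⁻¹ * (k⁻¹ * a * k) * t := by group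
    _ = t⁻¹ * a * t := by rw [h3]

/-! ### Fusion modulo a strongly closed subgroup -/

/-- Conjugation by `g` agrees on `A`, modulo `E`, with conjugation by an element of `S`. -/
def AgreesModulo {G : Type*} [Group G] (S E A : Subgroup G) (g : G) : Prop :=
  ∃ s ∈ S, ∀ a ∈ A, (s⁻¹ * a * s)⁻¹ * (g⁻¹ * a * g) ∈ E

/-- Every `p`-subgroup of the normalizer of `B` is conjugate into `S` within this normalizer. -/
def IsFullyNormalized {G : Type*} [Group G] (p : ℕ) (S B : Subgroup G) : Prop :=
  ∀ R : Subgroup G, R ≤ normalizer (B : Set G) → IsPGroup p R →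
    ∃ n ∈ normalizer (B : Set G), ∀ r ∈ R, n⁻¹ * r * n ∈ S

/-- The elements normalizing `B` and acting trivially on `B` modulo `E`. -/
def centralizerModulo {G : Type*} [Group G] {S E B : Subgroup G} (_hE : IsStronglyClosed E S)
    (_hB : B ≤ S) : Subgroup G where
  carrier := {k | k ∈ normalizer (B : Set G) ∧ ∀ b ∈ B, b⁻¹ * (k⁻¹ * b * k) ∈ E}
  one_mem' := ⟨one_mem _, fun b _ => by simp⟩
  mul_mem' := by
    rintro k l ⟨hk, hk'⟩ ⟨hl, hl'⟩
    refine ⟨mul_mem hk hl, fun b hb => ?_⟩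
    have := mul_mem (hk' b hb) (hl' _ (conj_mem_of_mem_normalizer hk hb))
    simpa [mul_assoc] using this
  inv_mem' := by
    rintro k ⟨hk, hk'⟩
    refine ⟨inv_mem hk, fun b hb => ?_⟩
    have hb' := (mem_normalizer_iff.mp hk b).mp hb
    have := inv_mem (hk' _ hb')
    simpa [mul_assoc] using this

theorem centralizerModulo_conj_mem {G : Type*} [Group G] {S E B : Subgroup G}
    {hE : IsStronglyClosed E S} {hB : B ≤ S} {k n : G} (hk : k ∈ centralizerModulo hE hB)
    (hn : n ∈ normalizer (B : Set G)) : n * k * n⁻¹ ∈ centralizerModulo hE hB := by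
  obtain ⟨hk, hk'⟩ := hk
  have hmem : ∀ {b}, b ∈ B → n * b * n⁻¹ ∈ B := fun hb => (mem_normalizer_iff.mp hn _).mp hb
  refine ⟨mul_mem (mul_mem hn hk) (inv_mem hn), fun b hb => ?_⟩
  have hb' := conj_mem_of_mem_normalizer hn hb
  have hc : (n⁻¹ * b * n)⁻¹ * (k⁻¹ * (n⁻¹ * b * n) * k) ∈ B :=
    mul_mem (inv_mem hb') (conj_mem_of_mem_normalizer hk hb')
  have := hE.2 _ (hk' _ hb') n⁻¹ (hB (by simpa [mul_assoc] using hmem hc))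
  simpa [mul_assoc] using this

section Agrees

variable {G : Type*} [Group G] {S E A A' : Subgroup G} {g h : G}

theorem AgreesModulo.mono (H : AgreesModulo S E A g) (hA : A' ≤ A) : AgreesModulo S E A' g :=
  let ⟨s, hs, H⟩ := H
  ⟨s, hs, fun a ha => H a (hA ha)⟩

theorem AgreesModulo.mul (hE : IsStronglyClosed E S) (hg : AgreesModulo S E A g)
    (hh : AgreesModulo S E A' h) (hA : ∀ a ∈ A, g⁻¹ * a * g ∈ A') :
    AgreesModulo S E A (g * h) := by
  obtain ⟨s, hs, hg⟩ := hg
  obtain ⟨t, ht, hh⟩ := hh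
  refine ⟨s * t, mul_mem hs ht, fun a ha => ?_⟩
  have := mul_mem (hE.conj_mem (hg a ha) ht) (hh _ (hA a ha))
  simpa [mul_assoc] using this

theorem AgreesModulo.inv (hE : IsStronglyClosed E S) (hg : AgreesModulo S E A g)
    (hA : ∀ a ∈ A', g * a * g⁻¹ ∈ A) : AgreesModulo S E A' g⁻¹ := by
  obtain ⟨s, hs, hg⟩ := hg
  refine ⟨s⁻¹, inv_mem hs, fun a ha => ?_⟩
  have := hE.conj_mem' (inv_mem (hg _ (hA a ha))) hs
  simpa [mul_assoc] using this

theorem agreesModulo_of_forall_mem (hA : ∀ a ∈ A, a⁻¹ * (g⁻¹ * a * g) ∈ E) :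
    AgreesModulo S E A g :=
  ⟨1, one_mem _, fun a ha => by simpa using hA a ha⟩

end Agrees

section FullyNormalized

variable {G : Type*} [Group G] {p : ℕ}

theorem IsFullyNormalized.exists_sylow {S B : Subgroup G} (hB : IsFullyNormalized p S B) :
    ∃ P : Sylow p (normalizer (B : Set G)),
      (P : Subgroup (normalizer (B : Set G))).map (normalizer (B : Set G)).subtype ≤ S := by
  obtain ⟨P⟩ : Nonempty (Sylow p (normalizer (B : Set G))) := inferInstance
  obtain ⟨n, hn, h⟩ := hB (P.1.map (normalizer (B : Set G)).subtype) (map_subtype_le _)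
    (P.2.map _)
  refine ⟨(⟨n, hn⟩ : normalizer (B : Set G))⁻¹ • P, ?_⟩
  rintro _ ⟨_, ⟨x, hx, rfl⟩, rfl⟩
  simpa using h x ⟨x, hx, rfl⟩

variable [Finite G] [Fact p.Prime]

/-- Choose `g` conjugating a Sylow `p`-subgroup of the normalizer of `A` into `S`; it then becomes a
Sylow subgroup of the normalizer of the conjugate. -/
theorem exists_isFullyNormalized_conjBy (S : Sylow p G) {A : Subgroup G} (hA : A ≤ S) :
    ∃ g : G, A.conjBy g ≤ S ∧ IsFullyNormalized p S (A.conjBy g) := by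
  obtain ⟨P, hAP⟩ :=
    ((S.2.to_le hA).comap_subtype (K := normalizer (A : Set G))).exists_le_sylow
  obtain ⟨g, hg⟩ := S.exists_conj_mem (P.2.map (normalizer (A : Set G)).subtype)
  refine ⟨g, fun x hx => ?_, fun R hR hRp => ?_⟩
  · rw [mem_conjBy] at hx
    have := hg _ ⟨⟨_, le_normalizer hx⟩, hAP hx, rfl⟩
    simpa [mul_assoc] using this
  · have hnorm : ∀ x, x ∈ normalizer (A.conjBy g : Set G) ↔
        g * x * g⁻¹ ∈ normalizer (A : Set G) := by
      intro x
      simp only [mem_normalizer_iff, mem_conjBy]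
      constructor
      · intro h y
        have := h (g⁻¹ * y * g)
        simpa [mul_assoc] using this
      · intro h y
        have := h (g * y * g⁻¹)
        simpa [mul_assoc] using this
    have hR' : R.conjBy g⁻¹ ≤ normalizer (A : Set G) := by
      intro x hx
      rw [mem_conjBy] at hx
      have := (hnorm _).mp (hR hx)
      simpa [mul_assoc] using this
    obtain ⟨n, hn⟩ := P.exists_conj_mem
      ((hRp.conjBy g⁻¹).comap_subtype (K := normalizer (A : Set G)))
    refine ⟨g⁻¹ * n * g, (hnorm _).mpr (by simp [mul_assoc]), fun r hr => ?_⟩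
    have hr' : g * r * g⁻¹ ∈ R.conjBy g⁻¹ := by rw [mem_conjBy]; simpa [mul_assoc] using hr
    have := hg _ ⟨_, hn ⟨_, hR' hr'⟩ hr', rfl⟩
    simpa [mul_assoc] using this

theorem isFullyNormalized_of_le_normalizer (S : Sylow p G) {B : Subgroup G}
    (hB : (S : Subgroup G) ≤ normalizer (B : Set G)) : IsFullyNormalized p S B := by
  intro R hR hRp
  obtain ⟨n, hn⟩ := (S.subtype hB).exists_conj_mem
    (hRp.comap_subtype (K := normalizer (B : Set G)))
  exact ⟨n, n.2, fun r hr => hn ⟨r, hR hr⟩ hr⟩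

end FullyNormalized

section Fusion

variable {G : Type*} [Group G] [Finite G] {p : ℕ} [Fact p.Prime] {S : Sylow p G}
  {T E : Subgroup G}

/-- A conjugation onto a fully normalized subgroup can be adjusted to one that extends to a larger
subgroup. -/
theorem IsFullyNormalized.exists_agreesModulo (hT : IsStronglyClosed T S)
    {A B : Subgroup G} (hA : A ≤ T) (hTA : ¬ T ≤ A)
    (ih : ∀ A₁ ≤ T, Nat.card A < Nat.card A₁ → ∀ g, (∀ a ∈ A₁, g⁻¹ * a * g ∈ T) →
      AgreesModulo S E A₁ g)
    (hB : IsFullyNormalized p S B) {u : G} (hu : ∀ x, u⁻¹ * x * u ∈ B ↔ x ∈ A) :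
    ∃ n ∈ normalizer (B : Set G), AgreesModulo S E A (u * n) := by
  -- `R` properly contains `A` because normalizers grow in `p`-groups, so `ih` applies to `R` once
  -- `n` has moved its conjugate by `u` into `S`.
  set R : Subgroup G := T ⊓ normalizer (A : Set G) with hR
  have hAR : A ≤ R := le_inf hA le_normalizer
  have hRp : IsPGroup p R := S.2.to_le (inf_le_left.trans hT.1)
  obtain ⟨x, hxT, hxN, hxA⟩ := (S.2.to_le hT.1).exists_mem_normalizer_notMem hA hTA
  have hRB : R.conjBy u ≤ normalizer (B : Set G) := by
    intro y hy
    rw [mem_conjBy] at hy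
    rw [mem_normalizer_iff]
    intro b
    have h1 := hu (u * b * u⁻¹)
    have h2 := hu (u * (y * b * y⁻¹) * u⁻¹)
    have h3 := mem_normalizer_iff.mp hy.2 (u * b * u⁻¹)
    simp only [mul_assoc, inv_mul_cancel, inv_mul_cancel_left, mul_one, mul_inv_rev,
      inv_inv] at h1 h2 h3 ⊢
    rw [h1, h2, h3]
  obtain ⟨n, hn, h⟩ := hB _ hRB (hRp.conjBy u)
  refine ⟨n, hn, (ih R inf_le_left ?_ (u * n) fun a ha => ?_).mono hAR⟩
  · refine lt_of_le_of_ne (card_le_of_le hAR) fun hcard => hxA ?_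
    rw [eq_of_le_of_card_ge hAR hcard.ge]
    exact ⟨hxT, hxN⟩
  · refine hT.2 a ha.1 _ ?_
    have := h _ (conj_mem_conjBy u ha)
    simpa [mul_assoc] using this

/-- The Frattini argument for the elements acting trivially modulo `E`: the normalizer of a fully
normalized subgroup `B` either satisfies the terminal condition or its action extends. -/
theorem IsFullyNormalized.agreesModulo_of_mem_normalizer (hT : IsStronglyClosed T S)
    (hE : IsStronglyClosed E S) {B : Subgroup G} (hBT : B ≤ T)
    (ih : ∀ A₁ ≤ T, Nat.card B < Nat.card A₁ → ∀ g, (∀ a ∈ A₁, g⁻¹ * a * g ∈ T) →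
      AgreesModulo S E A₁ g)
    (hB : IsFullyNormalized p S B) {k₀ : G} (hk₀T : k₀ ∈ T)
    (hk₀ : k₀ ∈ centralizerModulo hE (hBT.trans hT.1)) (hk₀B : k₀ ∉ B) {n : G}
    (hn : n ∈ normalizer (B : Set G)) : AgreesModulo S E B n := by
  set K := centralizerModulo hE (hBT.trans hT.1) with hK
  set N := normalizer (B : Set G) with hN
  have hKn : (K.subgroupOf N).Normal :=
    ⟨fun k hk m => centralizerModulo_conj_mem (mem_subgroupOf.mp hk) m.2⟩
  obtain ⟨P, hP⟩ := hB.exists_sylow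
  obtain ⟨Q, hQ⟩ := P.exists_coe_eq_subgroupOf (K.subgroupOf N)
  have hPS : ∀ x : N, (x : G) ∈ S → x ∈ P := by
    have : (S : Subgroup G).subgroupOf N = P :=
      P.3 S.2.comap_subtype fun x hx => hP ⟨x, hx, rfl⟩
    intro x hx
    exact this.le (mem_subgroupOf.mpr hx)
  have hQP : Q.map (K.subgroupOf N).subtype = P.1 ⊓ K.subgroupOf N := by
    rw [hQ, subgroupOf_map_subtype]
  -- Frattini for Q = P ∩ K: `k` acts trivially modulo `E`, while `m` normalizes `Q`, which contains
  -- T ∩ K. By strong closure the action of `m` extends to B(T ∩ K), larger than `B` because of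
  -- `k₀`.
  obtain ⟨m, hm, k, hk, hmk⟩ := mem_sup_of_normal_right.mp
    (Q.normalizer_sup_eq_top ▸ mem_top (⟨n, hn⟩⁻¹ : N))
  have hnk : n = (k : G)⁻¹ * (m : G)⁻¹ := by
    have : (m : G) * k = n⁻¹ := congrArg Subtype.val hmk
    rw [← mul_inv_rev, this, inv_inv]
  have hkB : AgreesModulo S E B (k : G)⁻¹ :=
    agreesModulo_of_forall_mem (inv_mem (show (k : G) ∈ K from hk)).2
  have hmT : ∀ a ∈ B ⊔ (T ⊓ K), (m : G)⁻¹⁻¹ * a * (m : G)⁻¹ ∈ T := by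
    have : B ⊔ (T ⊓ K) ≤ T.conjBy (m : G) := by
      refine sup_le (fun b hb => ?_) fun x hx => ?_ <;> rw [mem_conjBy]
      · exact hBT ((mem_normalizer_iff.mp m.2 b).mp hb)
      · have hxQ : (⟨x, hx.2.1⟩ : N) ∈ Q.map (K.subgroupOf N).subtype := by
          rw [hQP]
          exact ⟨hPS _ (hT.1 hx.1), hx.2⟩
        have hmx := (mem_normalizer_iff.mp hm _).mp hxQ
        rw [hQP] at hmx
        have hS : (m : G) * x * (m : G)⁻¹ ∈ (S : Subgroup G) := hP ⟨_, hmx.1, rfl⟩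
        simpa using hT.2 x hx.1 (m : G)⁻¹ (by simpa using hS)
    intro a ha
    simpa [mem_conjBy] using this ha
  have hBm : AgreesModulo S E B (m : G)⁻¹ := by
    refine (ih (B ⊔ (T ⊓ K)) (sup_le hBT inf_le_left) ?_ _ hmT).mono le_sup_left
    refine lt_of_le_of_ne (card_le_of_le le_sup_left) fun hcard => hk₀B ?_
    rw [eq_of_le_of_card_ge (le_sup_left (a := B)) hcard.ge]
    exact mem_sup_right ⟨hk₀T, hk₀⟩
  rw [hnk]
  exact hkB.mul hE hBm fun a ha => conj_mem_of_mem_normalizer (inv_mem hk.1) ha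

/-- Control of fusion modulo `E` inside a strongly closed subgroup `T`: it suffices to control the
normalizers of those fully normalized subgroups `B` of `T` which contain every element of `T` that
normalizes `B` and acts trivially on `B` modulo `E`. -/
theorem agreesModulo_of_forall_isFullyNormalized (hT : IsStronglyClosed T S)
    (hE : IsStronglyClosed E S)
    (H : ∀ (B : Subgroup G) (hB : B ≤ T), IsFullyNormalized p S B →
      T ⊓ centralizerModulo hE (hB.trans hT.1) ≤ B →
      ∀ n ∈ normalizer (B : Set G), AgreesModulo S E B n)
    (A : Subgroup G) (hA : A ≤ T) (g : G) (hg : ∀ a ∈ A, g⁻¹ * a * g ∈ T) :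
    AgreesModulo S E A g := by
  induction hc : Nat.card T - Nat.card A using Nat.strong_induction_on generalizing A g with
  | _ c ih =>
  by_cases hTA : T ≤ A
  · obtain rfl := le_antisymm hA hTA
    exact H A le_rfl (isFullyNormalized_of_le_normalizer S hT.le_normalizer) inf_le_left g
      (mem_normalizer_of_conj_mem hg)
  have ih' : ∀ A₁ ≤ T, Nat.card A < Nat.card A₁ → ∀ g, (∀ a ∈ A₁, g⁻¹ * a * g ∈ T) →
      AgreesModulo S E A₁ g := by
    intro A₁ hA₁ hlt g hg
    have := card_le_of_le hA₁
    exact ih _ (by omega) A₁ hA₁ g hg rfl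
  obtain ⟨h, hBS, hB⟩ := exists_isFullyNormalized_conjBy S (hA.trans hT.1)
  set B := A.conjBy h with hBdef
  have hBT : B ≤ T := by
    intro b hb
    have := hT.2 _ (hA (mem_conjBy.mp hb)) h (by simpa [mul_assoc] using hBS hb)
    simpa [mul_assoc] using this
  have hcardB : Nat.card B = Nat.card A := A.card_conjBy h
  have hA'T : A.conjBy g ≤ T := by
    intro x hx
    simpa [mul_assoc] using hg _ (mem_conjBy.mp hx)
  have hcardA' : Nat.card (A.conjBy g) = Nat.card A := A.card_conjBy g
  -- Both `A` and its conjugate by `g` are carried onto `B`, so `g` factors as (h n)(n⁻¹ n')(g⁻¹ h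
  -- n')⁻¹ with middle factor normalizing `B`.
  obtain ⟨n, hn, hAn⟩ := hB.exists_agreesModulo hT hA hTA ih' (u := h) fun x => by
    simp [hBdef, mem_conjBy, mul_assoc]
  obtain ⟨n', hn', hAn'⟩ := hB.exists_agreesModulo hT hA'T
    (fun hle => hTA (eq_of_le_of_card_ge hA ((card_le_of_le hle).trans hcardA'.le)).ge)
    (by rwa [hcardA']) (u := g⁻¹ * h) fun x => by simp [hBdef, mem_conjBy, mul_assoc]
  have hm : n⁻¹ * n' ∈ normalizer (B : Set G) := mul_mem (inv_mem hn) hn'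
  have hBm : AgreesModulo S E B (n⁻¹ * n') := by
    by_cases hclosed : T ⊓ centralizerModulo hE (hBT.trans hT.1) ≤ B
    · exact H B hBT hB hclosed _ hm
    · obtain ⟨k₀, hk₀, hk₀B⟩ := SetLike.not_le_iff_exists.mp hclosed
      exact hB.agreesModulo_of_mem_normalizer hT hE hBT (by rwa [hcardB]) hk₀.1 hk₀.2 hk₀B hm
  have hmemB : ∀ {k a}, k ∈ normalizer (B : Set G) → a ∈ A →
      (h * k)⁻¹ * a * (h * k) ∈ B := by
    intro k a hk ha
    have := conj_mem_of_mem_normalizer hk (conj_mem_conjBy h ha)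
    simpa [mul_assoc] using this
  have hfinal : AgreesModulo S E A (h * n * (n⁻¹ * n') * (g⁻¹ * h * n')⁻¹) := by
    refine (hAn.mul hE hBm fun a ha => hmemB hn ha).mul hE (A' := B)
      (hAn'.inv hE fun b hb => ?_) fun a ha => ?_
    · have := (mem_normalizer_iff.mp hn' b).mp hb
      rw [hBdef, mem_conjBy] at this
      rw [mem_conjBy]
      simpa [mul_assoc] using this
    · simpa [mul_assoc] using hmemB hn' ha
  convert hfinal using 1
  group

end Fusion

/-! ### Control of fusion by the normalizers of subgroups of a strongly closed subgroup -/

theorem conj_inv_zpow {G : Type*} [Group G] (g x : G) (k : ℤ) :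
    (g⁻¹ * x * g) ^ k = g⁻¹ * x ^ k * g := by
  simpa using conj_zpow (a := g⁻¹) (b := x) (i := k)

section Control

variable {G : Type*} [Group G] [Finite G] {p : ℕ} [Fact p.Prime] {S : Sylow p G} {D : Subgroup G}

theorem exists_conj_mul_mem_of_isPNilpotent_normalizer (hD : IsStronglyClosed D S)
    (hN : IsPNilpotent p (normalizer (D : Set G))) {x g : G} (hx : x ∈ S)
    (hxg : g⁻¹ * x * g ∈ S) : ∃ s ∈ S, (s⁻¹ * x * s)⁻¹ * (g⁻¹ * x * g) ∈ D := by
  have hS := isStronglyClosed_self (S : Subgroup G)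
  have key : AgreesModulo S D (zpowers x) g := by
    refine agreesModulo_of_forall_isFullyNormalized hS hD (fun B hB _ hclosed n hn => ?_) _
      ((zpowers_le (H := (S : Subgroup G))).mpr hx) g fun a ha => ?_
    -- Elements of `D` act trivially on `B` modulo `D`, so those normalizing `B` lie in `B`. If `D`
    -- were not inside `B`, normalizer growth in BD would contradict this.
    · have hDB : D ≤ B := by
        by_contra hDB
        have hBDS : B ⊔ D ≤ S := sup_le hB hD.1
        obtain ⟨y, hy, hyB, hyB'⟩ := (S.2.to_le hBDS).exists_mem_normalizer_notMem le_sup_left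
          (fun h => hDB (le_sup_right.trans h))
        have hBN : B ≤ normalizer (D : Set G) := hB.trans hD.le_normalizer
        rw [← SetLike.mem_coe, coe_mul_of_left_le_normalizer_right _ _ hBN] at hy
        obtain ⟨b, hb, d, hd, rfl⟩ := hy
        refine hyB' (mul_mem hb (hclosed ⟨hD.1 hd, ?_, fun c hc => ?_⟩))
        · simpa using mul_mem (inv_mem (le_normalizer hb)) hyB
        · have := mul_mem (hD.conj_mem (inv_mem hd) (hB hc)) hd
          simpa [mul_assoc] using this
      have hnD : n ∈ normalizer (D : Set G) := mem_normalizer_of_conj_mem fun d hd =>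
        hD.2 d hd n (hB (conj_mem_of_mem_normalizer hn (hDB hd)))
      obtain ⟨t, ht, h⟩ := hN.exists_conj_eq (S.subtype hD.le_normalizer)
        (A := B.subgroupOf _) (n := ⟨n, hnD⟩) (fun b hb => hB hb)
        (fun b hb => hB (conj_mem_of_mem_normalizer hn hb))
      refine ⟨t, ht, fun b hb => ?_⟩
      have := congrArg Subtype.val (h ⟨b, hD.le_normalizer (hB hb)⟩ hb)
      simp only [coe_mul, coe_inv] at this
      rw [this, inv_mul_cancel]
      exact one_mem _
    · obtain ⟨k, rfl⟩ := mem_zpowers_iff.mp ha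
      have := zpow_mem (K := (S : Subgroup G)) hxg k
      rwa [conj_inv_zpow] at this
  obtain ⟨s, hs, h⟩ := key
  exact ⟨s, hs, h x (mem_zpowers x)⟩

theorem exists_conj_eq_of_forall_isPNilpotent_normalizer (hD : IsStronglyClosed D S)
    (hN : ∀ U : Subgroup G, U ≤ D → D ⊓ centralizer (U : Set G) ≤ U →
      IsPNilpotent p (normalizer (U : Set G))) {x g : G} (hx : x ∈ D)
    (hxg : g⁻¹ * x * g ∈ S) : ∃ s ∈ S, g⁻¹ * x * g = s⁻¹ * x * s := by
  have hE := isStronglyClosed_bot (S : Subgroup G)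
  have key : AgreesModulo S ⊥ (zpowers x) g := by
    refine agreesModulo_of_forall_isFullyNormalized hD hE (fun B hB hBn hclosed n hn => ?_) _
      (zpowers_le.mpr hx) g fun a ha => ?_
    -- For trivial `E`, `hclosed` contains the condition C_D(B) ≤ B.
    · have hBN : IsPNilpotent p (normalizer (B : Set G)) := by
        refine hN B hB (le_trans (inf_le_inf_left _ fun c hc => ?_) hclosed)
        have hc' : ∀ b ∈ B, c⁻¹ * b * c = b := fun b hb => by
          rw [mul_assoc, mem_centralizer_iff.mp hc b hb, inv_mul_cancel_left]
        exact ⟨mem_normalizer_of_conj_mem fun b hb => by rwa [hc' b hb],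
          fun b hb => by simp [hc' b hb]⟩
      obtain ⟨P, hP⟩ := hBn.exists_sylow
      have hBnormal : (B.subgroupOf (normalizer (B : Set G))).Normal :=
        (normal_subgroupOf_iff_le_normalizer le_normalizer).mpr le_rfl
      have hBp : IsPGroup p (B.subgroupOf (normalizer (B : Set G))) :=
        (S.2.to_le (hB.trans hD.1)).comap_subtype
      have hBP : B.subgroupOf (normalizer (B : Set G)) ≤ P := hBp.le_sylow_of_normal P
      obtain ⟨t, ht, h⟩ := hBN.exists_conj_eq P (n := ⟨n, hn⟩) hBP
        (fun b hb => hBP (mem_subgroupOf.mpr (conj_mem_of_mem_normalizer hn hb)))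
      refine ⟨t, hP ⟨t, ht, rfl⟩, fun b hb => ?_⟩
      have := congrArg Subtype.val (h ⟨b, le_normalizer hb⟩ hb)
      simp only [coe_mul, coe_inv] at this
      rw [this, inv_mul_cancel]
      exact one_mem _
    · obtain ⟨k, rfl⟩ := mem_zpowers_iff.mp ha
      have := zpow_mem (hD.2 x hx g hxg) k
      rwa [conj_inv_zpow] at this
  obtain ⟨s, hs, h⟩ := key
  exact ⟨s, hs, (inv_mul_eq_one.mp (mem_bot.mp (h x (mem_zpowers x)))).symm⟩

end Control

/-! ### The subgroup generated by the elements of order prime to `p` -/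

/-- The subgroup generated by the elements of order prime to `p`. -/
def primeToPSubgroup (p : ℕ) (G : Type*) [Group G] : Subgroup G :=
  closure {g : G | (orderOf g).Coprime p}

section PrimeTo

variable {G : Type*} [Group G] {p : ℕ}

instance primeToPSubgroup_normal : (primeToPSubgroup p G).Normal := by
  refine ⟨fun x hx g => ?_⟩
  have hle : primeToPSubgroup p G ≤ (primeToPSubgroup p G).conjBy g := by
    refine (closure_le _).mpr fun y hy => ?_
    rw [SetLike.mem_coe, mem_conjBy]
    refine subset_closure ?_
    rw [Set.mem_ofPred_eq, ← MulAut.conj_apply, MulEquiv.orderOf_eq]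
    exact hy
  exact mem_conjBy.mp (hle hx)

/-- For each prime q ≠ p, the subgroup contains a whole Sylow `q`-subgroup. -/
theorem exists_index_primeToPSubgroup [Finite G] [Fact p.Prime] :
    ∃ n : ℕ, (primeToPSubgroup p G).index = p ^ n := by
  refine ⟨_, Nat.eq_prime_pow_of_unique_prime_dvd index_ne_zero_of_finite fun {q} hq hdvd => ?_⟩
  by_contra hqp
  have : Fact q.Prime := ⟨hq⟩
  obtain ⟨Q⟩ : Nonempty (Sylow q G) := inferInstance
  refine Q.not_dvd_index (hdvd.trans (index_dvd_of_le fun x hx => subset_closure ?_))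
  obtain ⟨k, hk⟩ := IsPGroup.iff_orderOf.mp Q.2 ⟨x, hx⟩
  rw [Subgroup.orderOf_mk] at hk
  rw [Set.mem_ofPred_eq, hk]
  exact ((Nat.coprime_primes hq Fact.out).mpr hqp).pow_left k

theorem primeToPSubgroup_hom_eq_one [Fact p.Prime] {H : Type*} [Group H] (hH : IsPGroup p H)
    (f : primeToPSubgroup p G →* H) (x : primeToPSubgroup p G) : f x = 1 := by
  have key : (closure {g : G | (orderOf g).Coprime p}) ≤ f.ker.map (Subgroup.subtype _) := by
    rw [closure_le]
    intro g hg
    refine ⟨⟨g, subset_closure hg⟩, ?_, rfl⟩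
    obtain ⟨k, hk⟩ := IsPGroup.iff_orderOf.mp hH (f ⟨g, subset_closure hg⟩)
    have h1 : orderOf (f ⟨g, subset_closure hg⟩) ∣ orderOf g :=
      (orderOf_map_dvd f _).trans (Subgroup.orderOf_mk g _).dvd
    rw [SetLike.mem_coe, MonoidHom.mem_ker, ← orderOf_eq_one_iff]
    refine Nat.eq_one_of_dvd_coprimes (Nat.Coprime.pow_right k hg) h1 (hk ▸ dvd_rfl)
  obtain ⟨y, hy, hyx⟩ := key x.2
  rwa [← Subtype.ext hyx]

/-- The focal subgroup of a Sylow subgroup of the subgroup generated by the elements of order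
prime to `p` is the whole Sylow subgroup. -/
theorem focalSubgroup_sylow_primeToPSubgroup [Finite G] [Fact p.Prime]
    (P : Sylow p (primeToPSubgroup p G)) : (P : Subgroup (primeToPSubgroup p G)) ≤
      (P : Subgroup (primeToPSubgroup p G)).focalSubgroup := by
  rw [← ker_transferFocal_inf_eq_focalSubgroup]
  refine le_inf (fun x _ => ?_) le_rfl
  exact primeToPSubgroup_hom_eq_one (P.2.to_quotient _) _ x

end PrimeTo

/-! ### Focal subgroups, nilpotency and the final argument -/

theorem Subgroup.le_of_le_commutator_sup {S : Type*} [Group S] [Group.IsNilpotent S]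
    {P D : Subgroup S} [D.Normal] (h : P ≤ ⁅P, ⊤⁆ ⊔ D) : P ≤ D := by
  set f := QuotientGroup.mk' D
  -- Modulo `D`, the image of `P` therefore lies in every term of the lower central series.
  have hf : P.map f ≤ ⁅P.map f, ⊤⁆ := by
    have := map_mono (f := f) h
    rwa [Subgroup.map_sup, map_commutator, map_top_of_surjective f (QuotientGroup.mk'_surjective D),
      (map_eq_bot_iff D).mpr (QuotientGroup.ker_mk' D).ge, sup_bot_eq] at this
  have hn : ∀ n, P.map f ≤ (⊤ : Subgroup (S ⧸ D)).lowerCentralSeries n := by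
    intro n
    induction n with
    | zero => exact le_top
    | succ n ih => exact hf.trans (commutator_mono ih le_rfl)
  obtain ⟨n, h0⟩ := nilpotent_iff_lowerCentralSeries.mp
    (inferInstance : Group.IsNilpotent (S ⧸ D))
  have := (map_eq_bot_iff P).mp (le_bot_iff.mp ((hn n).trans h0.le))
  rwa [QuotientGroup.ker_mk'] at this

section Main

variable {G : Type*} [Group G] [Finite G] {p : ℕ} [Fact p.Prime] {S : Sylow p G}

/-- If conjugation in `G` of elements of a part of the Sylow subgroup lying in `O^p(G)` is
controlled by `S` modulo a strongly closed subgroup `E`, then that part lies in `E`. -/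
theorem inf_primeToPSubgroup_le_of_forall_exists {E : Subgroup G} (hE : IsStronglyClosed E S)
    (h : ∀ x ∈ (S : Subgroup G) ⊓ primeToPSubgroup p G, ∀ g : G, g⁻¹ * x * g ∈ S →
      ∃ s ∈ S, (s⁻¹ * x * s)⁻¹ * (g⁻¹ * x * g) ∈ E) :
    (S : Subgroup G) ⊓ primeToPSubgroup p G ≤ E := by
  set N := primeToPSubgroup p G with hN
  have := S.2.isNilpotent
  have hEn : (E.subgroupOf S).Normal :=
    (normal_subgroupOf_iff_le_normalizer hE.1).mpr hE.le_normalizer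
  obtain ⟨P, hP⟩ := S.exists_coe_eq_subgroupOf N
  set C : Subgroup S := ⁅N.subgroupOf S, ⊤⁆ ⊔ E.subgroupOf S with hC
  have hfoc : (P : Subgroup N).focalSubgroup ≤ (C.map (Subgroup.subtype _)).subgroupOf N := by
    rw [focalSubgroup_def, closure_le]
    rintro _ ⟨hmem, x, hx, u, rfl⟩
    rw [hP, mem_subgroupOf] at hmem hx
    -- Applying `h` to x⁻¹ and u⁻¹ gives `s` such that [x, u] is [x, s⁻¹] times an element of `E`.
    have hux : (u : G)⁻¹⁻¹ * (x : G)⁻¹ * (u : G)⁻¹ ∈ (S : Subgroup G) := by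
      have := mul_mem (inv_mem hx) hmem
      simpa [commutatorElement_def, mul_assoc, -SetLike.mem_coe] using this
    obtain ⟨s, hs, hse⟩ := h (x : G)⁻¹
      ⟨inv_mem (S := Subgroup G) hx, inv_mem (S := Subgroup G) x.2⟩ (u : G)⁻¹ hux
    have hxs : ⁅(⟨x, hx⟩ : S), (⟨s, hs⟩ : S)⁻¹⁆ ∈ C :=
      mem_sup_left (commutator_mem_commutator (mem_subgroupOf.mpr x.2) (mem_top _))
    refine ⟨_, mul_mem hxs (mem_sup_right (T := E.subgroupOf S) (x := ⟨_, hE.1 hse⟩) hse), ?_⟩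
    simp [commutatorElement_def, mul_assoc]
  have hle : N.subgroupOf S ≤ E.subgroupOf S := by
    refine le_of_le_commutator_sup fun x hx => ?_
    have hxP : (⟨x, hx⟩ : N) ∈ (P : Subgroup N) := by
      rw [hP]
      exact x.2
    obtain ⟨y, hy, hyx⟩ := hfoc (focalSubgroup_sylow_primeToPSubgroup P hxP)
    rwa [← Subtype.ext hyx]
  exact fun x hx => hle (x := ⟨x, hx.1⟩) hx.2

theorem isPNilpotent_of_inf_primeToPSubgroup_eq_bot
    (h : (S : Subgroup G) ⊓ primeToPSubgroup p G = ⊥) : IsPNilpotent p G := by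
  refine ⟨primeToPSubgroup p G, inferInstance, ?_, exists_index_primeToPSubgroup⟩
  obtain ⟨P, hP⟩ := S.exists_coe_eq_subgroupOf (primeToPSubgroup p G)
  have hbot : (P : Subgroup (primeToPSubgroup p G)) = ⊥ := by
    rw [hP, subgroupOf_eq_bot, disjoint_iff, h]
  have := P.not_dvd_index
  rw [hbot, index_bot] at this
  exact ((Nat.Prime.coprime_iff_not_dvd Fact.out).mpr this).symm

end Main

theorem mainTheorem5 {G : Type*} [Group G] [Finite G] (p : ℕ) [Fact p.Prime]
    (S : Sylow p G) (D : Subgroup G) (hD : IsStronglyClosed D (S : Subgroup G)) :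
    IsPNilpotent p G ↔
      ∀ U : Subgroup G, U ≤ D → D ⊓ Subgroup.centralizer (U : Set G) ≤ U →
        IsPNilpotent p (Subgroup.normalizer (U : Set G)) := by
  refine ⟨fun h U _ _ => h.subgroup _, fun h => ?_⟩
  have hle : (S : Subgroup G) ⊓ primeToPSubgroup p G ≤ D :=
    inf_primeToPSubgroup_le_of_forall_exists hD fun x hx g hg =>
      exists_conj_mul_mem_of_isPNilpotent_normalizer hD (h D le_rfl inf_le_left) hx.1 hg
  refine isPNilpotent_of_inf_primeToPSubgroup_eq_bot (S := S) (le_bot_iff.mp ?_)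
  refine inf_primeToPSubgroup_le_of_forall_exists (isStronglyClosed_bot _) fun x hx g hg => ?_
  obtain ⟨s, hs, hxs⟩ := exists_conj_eq_of_forall_isPNilpotent_normalizer hD h (hle hx) hg
  exact ⟨s, hs, by rw [hxs, inv_mul_cancel]; exact one_mem _⟩
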